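/- Let $\mathbb L=[0,\infty]$ be the tropical semiring (sum $\inf$, product $+$, zero $\infty$, unit $0$), and for a set $X$ let $!X$ be the set of finite multisets on $X$ and $!_nX$ the set of those of cardinality at most $n$. A matrix $t\in\mathbb L^{!X\times Y}$ defines the function $t^!:\mathbb L^X\to\mathbb L^Y$, $t^!(x)_b=\inf_{\mu\in !X}\{\mu x+t_{\mu,b}\}$, where $\mu x=\sum_{a}\mu(a)x_a$. It is a tropical polynomial in its component $b$ if $X$ is finite and that component is $x\mapsto\min_{\mu\in I}\{\mu x+c_\mu\}$ for some finite $I\subseteq{!X}$ and $c_\mu\in\mathbb L$. Let $\mathbb L^X$ carry the (possibly infinite) distance $d(x,y)=\sup_{a\in X}|x_a-y_a|$, with $|\infty-\infty|=0$ and $|\infty-r|=\infty$ for $r<\infty$. A function $f:\mathbb L^X\to\mathbb L$ is Lipschitz if for some $K<\infty$ one has $|f(x)-f(y)|\le K\,d(x,y)$ for all $x,y$, and locally Lipschitz if it is Lipschitz on a ball around each point of the interior of $(0,\infty]^X$ for $d$ (the set of the $x$ with $\inf_{a}x_a>0$; it contains $(0,\infty)^X$ if $X$ is finite). Consider the weighted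 relational model over $\mathbb L$, with the ground type $o$ of the simply typed $\lambda$-calculus STLC, of its differential extension ST$\partial$LC (terms $x$, $\lambda x.M$, $M\mathbb T$, $\mathsf D[M,N]$, where $\mathbb T$ is a finite sum of terms) and of its graded variant $\mathsf b$STLC (types $o$ and $!_nA\multimap B$, contexts $x_1:_{n_1}A_1,\dots,x_k:_{n_k}A_k$) interpreted by an arbitrary set $O$, and the type of numbers of PCF$^{\mathbb L}$ (PCF with the operations $\alpha\cdot M$, $\alpha\in\mathbb L$, and $M+N$) interpreted by $\mathbb N$. In STLC, ST$\partial$LC and PCF$^{\mathbb L}$ one has $[\![A\to B]\!]={!}[\![A]\!]\times[\![B]\!]$, contexts are interpreted by disjoint unions, and a term $\Gamma\vdash M:A$ by a matrix $[\![M]\!]\in\mathbb L^{![\![\Gamma]\!]\times[\![A]\!]}$, through the cartesian closed structure of the coKleisli category of $!$, its differential operator $(Dt)_{\mu\oplus\rho,b}=t_{\rho+\mu,b}$ if $\#\mu=1$ and $\infty$ otherwise, $[\![0]\!]=\infty$, $[\![M+N]\!]=\min\{[\![M]\!],[\![N]\!]\}$, $[\![\alpha\cdot M]\!]=[\![M]\!]+\alpha$,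 and fixpoints as infima of their finite approximants starting from the matrix $\infty$. In $\mathsf b$STLC one has $[\![{!_nA}\multimap B]\!]={!_n}[\![A]\!]\times[\![B]\!]$, and a derivation of $x_1:_{n_1}A_1,\dots,x_k:_{n_k}A_k\vdash M:A$ is interpreted, through the graded exponential comonad $(!_n)_n$, by a matrix indexed by $\prod_i{!_{n_i}}[\![A_i]\!]\times[\![A]\!]$, where $\prod_i{!_{n_i}}[\![A_i]\!]$ is seen as a subset of ${!}\big(\sum_i[\![A_i]\!]\big)$ (the entries outside it being $\infty$). The Taylor expansion $\mathcal T(M)$ of an STLC term is the set of ST$\partial$LC terms given by $\mathcal T(x)=\{x\}$, $\mathcal T(\lambda x.M)=\{\lambda x.t\mid t\in\mathcal T(M)\}$ and $\mathcal T(MN)=\{\mathsf D^k[t,u_1,\dots,u_k]0\mid k\in\mathbb N,\ t\in\mathcal T(M),\ u_i\in\mathcal T(N)\}$. Let $\Gamma\vdash M:A$ be a typed term of one of these calculi and $a\in[\![A]\!]$. 1. If $M$ is a term of $\mathsf b$STLC and $O$ is finite, then $[\![M]\!]^!_a$ is a tropical polynomial, and it is Lipschitz. 2. If $M$ is a term of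 STLC and $t\in\mathcal T(M)$, then $[\![t]\!]^!_a$ (the interpretation of $t$ in ST$\partial$LC) is Lipschitz. 3. If $M$ is a term of STLC or of PCF$^{\mathbb L}$, then $[\![M]\!]^!_a$ is locally Lipschitz. 4. If $M$ is a term of STLC, then $[\![M]\!]^!_a(x)=\inf_{t\in\mathcal T(M)}[\![t]\!]^!_a(x)$ for all $x\in\mathbb L^{[\![\Gamma]\!]}$, and all the functions $[\![t]\!]^!_a$ are Lipschitz. -/

import Mathlib

open scoped ENNReal NNReal

universe u v w

noncomputable section

namespace Trop

/-! ## The tropical semiring `𝕃 = [0,∞]`, with `inf` as sum and `+` as product -/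

/-- The indicator of a proposition in the tropical semiring: the unit `0` if it holds, the zero `∞`
otherwise. -/
def ind (p : Prop) : ℝ≥0∞ :=
  open Classical in if p then 0 else ⊤

/-- The distance `|r - s|` on `[0,∞]`, with `|∞ - ∞| = 0` and `|∞ - r| = ∞` for `r < ∞`. -/
def ldist (r s : ℝ≥0∞) : ℝ≥0∞ := max (r - s) (s - r)

/-- The sup-norm distance on `𝕃^X`. -/
def supDist {X : Type u} (x y : X → ℝ≥0∞) : ℝ≥0∞ := ⨆ a, ldist (x a) (y a)

/-- The scalar product `μ x = ∑ₐ μ(a) xₐ` of a finite multiset and a point of `𝕃^X`. -/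
def dot {X : Type u} (μ : Multiset X) (x : X → ℝ≥0∞) : ℝ≥0∞ := (μ.map x).sum

/-- Tropical polynomials in the finite set of variables `X`; the exponents in `ℕ^X` are written as
finite multisets. -/
def IsTropicalPolynomial {X : Type u} (f : (X → ℝ≥0∞) → ℝ≥0∞) : Prop :=
  Finite X ∧ ∃ (I : Finset (Multiset X)) (c : Multiset X → ℝ≥0∞),
    ∀ x, f x = ⨅ μ ∈ I, (dot μ x + c μ)

/-- (Globally) Lipschitz functions for the sup-norm distance. -/
def IsLipschitz {X : Type u} (f : (X → ℝ≥0∞) → ℝ≥0∞) : Prop :=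
  ∃ K : ℝ≥0, ∀ x y, ldist (f x) (f y) ≤ K * supDist x y

/-- The interior, for the sup-norm distance, of the set `(0,∞]^X`. -/
def posInterior (X : Type u) : Set (X → ℝ≥0∞) :=
  {x | ∃ ε : ℝ≥0∞, 0 < ε ∧ ∀ y, supDist x y < ε → ∀ a, 0 < y a}

/-- `f` is Lipschitz on a ball around each point of the interior of `(0,∞]^X`. -/
def IsLocallyLipschitz {X : Type u} (f : (X → ℝ≥0∞) → ℝ≥0∞) : Prop :=
  ∀ x ∈ posInterior X, ∃ δ : ℝ≥0∞, 0 < δ ∧ ∃ K : ℝ≥0, ∀ y z,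
    supDist x y < δ → supDist x z < δ → ldist (f y) (f z) ≤ K * supDist y z

/-! ## Matrices over `𝕃` -/

/-- Morphisms `X ⟶ Y` of the category of `𝕃`-valued matrices. -/
abbrev Mat (X : Type u) (Y : Type v) : Type (max u v) := X → Y → ℝ≥0∞

variable {X : Type u} {Y : Type v} {Z : Type w}

/-- Composition of matrices. -/
def comp (s : Mat Y Z) (t : Mat X Y) : Mat X Z := fun a c => ⨅ b, (s b c + t a b)

/-- The action on matrices of the tensor product, which is the cartesian product of sets. -/
def tensor {X' : Type u} {Y' : Type v} (s : Mat X Y) (t : Mat X' Y') : Mat (X × X') (Y × Y') :=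
  fun p q => s p.1 q.1 + t p.2 q.2

/-! ### The exponential comonad `!` and its coKleisli category -/

/-- The functor `!` on matrices. A multiset `ρ` of pairs with projections `[x₁,…,xₖ]` and
`[y₁,…,yₖ]` is the same as a matching `σ` of the `xᵢ` with the `y_σ(i)`, so this is
`min_σ ∑ᵢ f(xᵢ, y_σ(i))`, and `∞` if the cardinalities differ. -/
def bang (f : Mat X Y) : Mat (Multiset X) (Multiset Y) := fun α β =>
  ⨅ (ρ : Multiset (X × Y)) (_ : ρ.map Prod.fst = α ∧ ρ.map Prod.snd = β),
    (ρ.map fun p => f p.1 p.2).sum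

/-- The counit of `!`. -/
def der (X : Type u) : Mat (Multiset X) X := fun μ a => ind (μ = {a})

/-- The comultiplication of `!`. -/
def dig (X : Type u) : Mat (Multiset X) (Multiset (Multiset X)) := fun μ B => ind (μ = B.sum)

/-- Morphisms `X ⟶ Y` of the coKleisli category of `!`. -/
abbrev KMat (X : Type u) (Y : Type v) : Type (max u v) := Mat (Multiset X) Y

/-- CoKleisli composition. -/
def kcomp (s : KMat Y Z) (t : KMat X Y) : KMat X Z := comp s (comp (bang t) (dig X))

/-- The generalized tropical power series `t^! : 𝕃^X → 𝕃^Y` of a coKleisli morphism. -/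
def toFun (t : KMat X Y) (x : X → ℝ≥0∞) (b : Y) : ℝ≥0∞ := ⨅ μ : Multiset X, (dot μ x + t μ b)

/-- The isomorphism `!X × !Y ≅ !(X + Y)`. -/
def oplus (μ : Multiset X) (ν : Multiset Y) : Multiset (X ⊕ Y) :=
  μ.map Sum.inl + ν.map Sum.inr

/-- First projection of the cartesian product `X + Y`. -/
def kfst (X : Type u) (Y : Type v) : KMat (X ⊕ Y) X := fun μ a => ind (μ = {Sum.inl a})

/-- Second projection of the cartesian product `X + Y`. -/
def ksnd (X : Type u) (Y : Type v) : KMat (X ⊕ Y) Y := fun μ b => ind (μ = {Sum.inr b})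

/-- Pairing into the cartesian product `X + Y`. -/
def kpair (t : KMat Z X) (s : KMat Z Y) : KMat Z (X ⊕ Y) := fun μ => Sum.elim (t μ) (s μ)

/-- Evaluation; the exponential object of `X` and `Y` is `!X × Y`. -/
def kev (X : Type u) (Y : Type v) : KMat ((Multiset X × Y) ⊕ X) Y := fun μ y =>
  ind (∃ ρ : Multiset X, μ = oplus {(ρ, y)} ρ)

/-- Currying. -/
def kcurry (t : KMat (Z ⊕ X) Y) : KMat Z (Multiset X × Y) := fun ρ p => t (oplus ρ p.1) p.2

/-- Uncurrying. -/
def kuncurry (t : KMat Z (Multiset X × Y)) : KMat (Z ⊕ X) Y :=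
  kcomp (kev X Y) (kpair (kcomp t (kfst Z X)) (ksnd Z X))

/-- The zero morphism. -/
def kzero (X : Type u) (Y : Type v) : KMat X Y := fun _ _ => ⊤

/-- The differential operator: `(Dt)_{μ ⊕ ρ, b} = t_{ρ + μ, b}` if `#μ = 1`, and `∞` otherwise. -/
def kD (t : KMat X Y) : KMat (X ⊕ X) Y := fun ν b =>
  if (ν.filterMap Sum.getLeft?).card = 1 then
    t (ν.filterMap Sum.getRight? + ν.filterMap Sum.getLeft?) b
  else ⊤

/-- `u ⋆ s`: the derivative of `u` in its second component, applied to `s`. -/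
def kstar (u : KMat (Z ⊕ X) Y) (s : KMat Z X) : KMat (Z ⊕ X) Y :=
  kcomp (kD u) (kpair (kpair (kzero (Z ⊕ X) Z) (kcomp s (kfst Z X))) (der (Z ⊕ X)))

/-- The approximants of the fixpoint morphism. -/
def kfixN (X : Type u) : ℕ → KMat (Multiset X × X) X
  | 0 => kzero _ _
  | n + 1 => kcomp (kev X X) (kpair (der _) (kfixN X n))

/-- The fixpoint morphism. -/
def kfix (X : Type u) : KMat (Multiset X × X) X := fun μ a => ⨅ n, kfixN X n μ a

/-! ## The simply typed λ-calculus

Terms are typed and use de Bruijn indices, so that a term is the same as a typing derivation. -/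

/-- Simple types over one ground type. -/
inductive Ty : Type
  | o : Ty
  | arr : Ty → Ty → Ty

/-- Contexts; the last declared variable is at the head. -/
abbrev Ctx : Type := List Ty

/-- The occurrences of a type in a context, that is the variables of that type. -/
inductive Var : Ctx → Ty → Type
  | zero {Γ : Ctx} {A : Ty} : Var (A :: Γ) A
  | succ {Γ : Ctx} {A B : Ty} : Var Γ A → Var (B :: Γ) A

/-- Terms of the simply typed λ-calculus. -/
inductive Tm : Ctx → Ty → Type
  | var {Γ : Ctx} {A : Ty} : Var Γ A → Tm Γ A
  | lam {Γ : Ctx} {A B : Ty} : Tm (A :: Γ) B → Tm Γ (Ty.arr A B)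
  | app {Γ : Ctx} {A B : Ty} : Tm Γ (Ty.arr A B) → Tm Γ A → Tm Γ B

/-- Interpretation of types, where the ground type is interpreted by the set `O`. -/
def Ty.Sem (O : Type u) : Ty → Type u
  | Ty.o => O
  | Ty.arr A B => Multiset (A.Sem O) × B.Sem O

/-- Interpretation of contexts. -/
def Ctx.Sem (O : Type u) : Ctx → Type u
  | [] => PEmpty
  | A :: Γ => Ctx.Sem O Γ ⊕ A.Sem O

/-- Interpretation of variables by projections. -/
def Var.sem (O : Type u) : {Γ : Ctx} → {A : Ty} → Var Γ A → KMat (Ctx.Sem O Γ) (A.Sem O)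
  | _, _, @Var.zero Γ A => ksnd (Ctx.Sem O Γ) (A.Sem O)
  | _, _, @Var.succ Γ _ B x => kcomp (Var.sem O x) (kfst (Ctx.Sem O Γ) (B.Sem O))

/-- Interpretation of the simply typed λ-calculus. -/
def Tm.sem (O : Type u) : {Γ : Ctx} → {A : Ty} → Tm Γ A → KMat (Ctx.Sem O Γ) (A.Sem O)
  | _, _, Tm.var x => x.sem O
  | _, _, Tm.lam M => kcurry (Tm.sem O M)
  | _, _, Tm.app M N => kcomp (kev _ _) (kpair (Tm.sem O M) (Tm.sem O N))

/-! ## PCF with tropical scalars and sums -/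

/-- Terms of `PCF^𝕃`; the ground type is the type of natural numbers. -/
inductive PTm : Ctx → Ty → Type
  | var {Γ : Ctx} {A : Ty} : Var Γ A → PTm Γ A
  | lam {Γ : Ctx} {A B : Ty} : PTm (A :: Γ) B → PTm Γ (Ty.arr A B)
  | app {Γ : Ctx} {A B : Ty} : PTm Γ (Ty.arr A B) → PTm Γ A → PTm Γ B
  | fix {Γ : Ctx} {A : Ty} : PTm Γ (Ty.arr A A) → PTm Γ A
  | num {Γ : Ctx} : ℕ → PTm Γ Ty.o
  | succ {Γ : Ctx} : PTm Γ Ty.o → PTm Γ Ty.o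
  | pred {Γ : Ctx} : PTm Γ Ty.o → PTm Γ Ty.o
  | ifz {Γ : Ctx} {A : Ty} : PTm Γ Ty.o → PTm Γ A → PTm Γ A → PTm Γ A
  | smul {Γ : Ctx} {A : Ty} : ℝ≥0∞ → PTm Γ A → PTm Γ A
  | add {Γ : Ctx} {A : Ty} : PTm Γ A → PTm Γ A → PTm Γ A

/-- The linear morphism of a function on ground values. -/
def klin (f : X → Y) : KMat X Y := fun μ b => ind (∃ a, μ = {a} ∧ b = f a)

/-- The conditional: it uses the test once, and once the branch that the test selects. -/
def kifz (X : Type u) : KMat (ℕ ⊕ (X ⊕ X)) X := fun μ a =>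
  ind (μ = {Sum.inl 0, Sum.inr (Sum.inl a)} ∨ ∃ n : ℕ, μ = {Sum.inl (n + 1), Sum.inr (Sum.inr a)})

/-- Interpretation of `PCF^𝕃`. -/
def PTm.sem : {Γ : Ctx} → {A : Ty} → PTm Γ A → KMat (Ctx.Sem ℕ Γ) (A.Sem ℕ)
  | _, _, PTm.var x => x.sem ℕ
  | _, _, PTm.lam M => kcurry (PTm.sem M)
  | _, _, PTm.app M N => kcomp (kev _ _) (kpair (PTm.sem M) (PTm.sem N))
  | _, _, PTm.fix M => kcomp (kfix _) (PTm.sem M)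
  | _, _, PTm.num n => fun μ (m : ℕ) => ind (μ = 0 ∧ m = n)
  | _, _, PTm.succ M => kcomp (klin Nat.succ : KMat ℕ ℕ) (PTm.sem M)
  | _, _, PTm.pred M => kcomp (klin Nat.pred : KMat ℕ ℕ) (PTm.sem M)
  | _, _, @PTm.ifz _ A P M N =>
      kcomp (kifz (A.Sem ℕ)) (kpair (PTm.sem P : KMat _ ℕ) (kpair (PTm.sem M) (PTm.sem N)))
  | _, _, PTm.smul α M => fun μ a => PTm.sem M μ a + α
  | _, _, PTm.add M N => fun μ a => min (PTm.sem M μ a) (PTm.sem N μ a)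

/-! ## The simply typed differential λ-calculus -/

mutual

/-- Terms of the differential λ-calculus, before the quotient by the equations on sums and on
consecutive differentials. -/
inductive DTm : Ctx → Ty → Type
  | var {Γ : Ctx} {A : Ty} : Var Γ A → DTm Γ A
  | lam {Γ : Ctx} {A B : Ty} : DTm (A :: Γ) B → DTm Γ (Ty.arr A B)
  | app {Γ : Ctx} {A B : Ty} : DTm Γ (Ty.arr A B) → DSum Γ A → DTm Γ B
  | diff {Γ : Ctx} {A B : Ty} : DTm Γ (Ty.arr A B) → DTm Γ A → DTm Γ (Ty.arr A B)

/-- Sums of the differential λ-calculus. -/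
inductive DSum : Ctx → Ty → Type
  | zero {Γ : Ctx} {A : Ty} : DSum Γ A
  | single {Γ : Ctx} {A : Ty} : DTm Γ A → DSum Γ A
  | add {Γ : Ctx} {A : Ty} : DTm Γ A → DSum Γ A → DSum Γ A

end

mutual

/-- Interpretation of terms of the differential λ-calculus. -/
def DTm.sem (O : Type u) : {Γ : Ctx} → {A : Ty} → DTm Γ A → KMat (Ctx.Sem O Γ) (A.Sem O)
  | _, _, DTm.var x => x.sem O
  | _, _, DTm.lam M => kcurry (DTm.sem O M)
  | _, _, DTm.app M T => kcomp (kev _ _) (kpair (DTm.sem O M) (DSum.sem O T))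
  | _, _, DTm.diff M N => kcurry (kstar (kuncurry (DTm.sem O M)) (DTm.sem O N))

/-- Interpretation of sums of the differential λ-calculus. -/
def DSum.sem (O : Type u) : {Γ : Ctx} → {A : Ty} → DSum Γ A → KMat (Ctx.Sem O Γ) (A.Sem O)
  | _, _, DSum.zero => kzero _ _
  | _, _, DSum.single M => DTm.sem O M
  | _, _, DSum.add M T => fun μ a => min (DTm.sem O M μ a) (DSum.sem O T μ a)

end

/-- The resource application `t·⟨u₁,…,uₖ⟩ = D^k[t, u₁,…,uₖ] 0`. -/
def DTm.rapp {Γ : Ctx} {A B : Ty} (t : DTm Γ (Ty.arr A B)) (us : List (DTm Γ A)) : DTm Γ B :=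
  DTm.app (us.foldl DTm.diff t) DSum.zero

/-- The Taylor expansion of a simply typed λ-term. -/
def Tm.taylor : {Γ : Ctx} → {A : Ty} → Tm Γ A → Set (DTm Γ A)
  | _, _, Tm.var x => {DTm.var x}
  | _, _, Tm.lam M => {s | ∃ t ∈ Tm.taylor M, s = DTm.lam t}
  | _, _, Tm.app M N =>
      {s | ∃ t ∈ Tm.taylor M, ∃ us, (∀ u ∈ us, u ∈ Tm.taylor N) ∧ s = DTm.rapp t us}

/-! ## The graded simply typed λ-calculus -/

/-- Graded types: the ground type and `!ₙ A ⊸ B`. -/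
inductive BTy : Type
  | o : BTy
  | limp : ℕ → BTy → BTy → BTy

/-- Graded contexts: `(n, A)` is a declaration `x :ₙ A`. -/
abbrev BCtx : Type := List (ℕ × BTy)

/-- The context `nΓ`. -/
def BCtx.scale (n : ℕ) (Γ : BCtx) : BCtx := Γ.map fun d => (n * d.1, d.2)

/-- Untyped λ-terms with de Bruijn indices. -/
inductive Lam : Type
  | var : ℕ → Lam
  | lam : Lam → Lam
  | app : Lam → Lam → Lam

/-- Lifting of a renaming under a binder. -/
def liftRen (r : ℕ → ℕ) : ℕ → ℕ
  | 0 => 0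
  | i + 1 => r i + 1

/-- Renaming of free variables. -/
def Lam.rename : (ℕ → ℕ) → Lam → Lam
  | r, Lam.var i => Lam.var (r i)
  | r, Lam.lam M => Lam.lam (M.rename (liftRen r))
  | r, Lam.app M N => Lam.app (M.rename r) (N.rename r)

/-- `BMerge Γ Δ Θ` says that `Θ` is a sum `Γ + Δ`, where some declarations of `Γ` and `Δ` are
declarations of a common variable. -/
inductive BMerge : BCtx → BCtx → BCtx → Type
  | nil : BMerge [] [] []
  | left {Γ Δ Θ : BCtx} (d : ℕ × BTy) : BMerge Γ Δ Θ → BMerge (d :: Γ) Δ (d :: Θ)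
  | right {Γ Δ Θ : BCtx} (d : ℕ × BTy) : BMerge Γ Δ Θ → BMerge Γ (d :: Δ) (d :: Θ)
  | both {Γ Δ Θ : BCtx} (m n : ℕ) (A : BTy) :
      BMerge Γ Δ Θ → BMerge ((m, A) :: Γ) ((n, A) :: Δ) ((m + n, A) :: Θ)

/-- Where the variables of `Γ` are found in `Γ + Δ`. -/
def BMerge.renL : {Γ Δ Θ : BCtx} → BMerge Γ Δ Θ → ℕ → ℕ
  | _, _, _, BMerge.nil => id
  | _, _, _, BMerge.left _ h => liftRen h.renL
  | _, _, _, BMerge.right _ h => fun i => h.renL i + 1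
  | _, _, _, BMerge.both _ _ _ h => liftRen h.renL

/-- Where the variables of `Δ` are found in `Γ + Δ`. -/
def BMerge.renR : {Γ Δ Θ : BCtx} → BMerge Γ Δ Θ → ℕ → ℕ
  | _, _, _, BMerge.nil => id
  | _, _, _, BMerge.left _ h => fun i => h.renR i + 1
  | _, _, _, BMerge.right _ h => liftRen h.renR
  | _, _, _, BMerge.both _ _ _ h => liftRen h.renR

/-- Exchange of two adjacent declarations. -/
inductive BSwap : BCtx → BCtx → Type
  | head (d e : ℕ × BTy) (Γ : BCtx) : BSwap (d :: e :: Γ) (e :: d :: Γ)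
  | tail {Γ Δ : BCtx} (d : ℕ × BTy) : BSwap Γ Δ → BSwap (d :: Γ) (d :: Δ)

/-- The renaming that goes with an exchange. -/
def BSwap.ren : {Γ Δ : BCtx} → BSwap Γ Δ → ℕ → ℕ
  | _, _, BSwap.head _ _ _ => Equiv.swap 0 1
  | _, _, BSwap.tail _ h => liftRen h.ren

/-- The renaming that identifies the first two variables. -/
def contrRen : ℕ → ℕ
  | 0 => 0
  | i + 1 => i

/-- Typing derivations `Γ ⊢ M : A`. As contexts are lists and not sets, exchange is explicit. -/
inductive BTyping : BCtx → Lam → BTy → Type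
  | var (A : BTy) : BTyping [(1, A)] (Lam.var 0) A
  | weak {Γ : BCtx} {M : Lam} {A : BTy} (B : BTy) :
      BTyping Γ M A → BTyping ((0, B) :: Γ) (M.rename Nat.succ) A
  | contr {Γ : BCtx} {M : Lam} {A : BTy} (n m : ℕ) (B : BTy) :
      BTyping ((n, B) :: (m, B) :: Γ) M A → BTyping ((n + m, B) :: Γ) (M.rename contrRen) A
  | exch {Γ Δ : BCtx} {M : Lam} {A : BTy} (h : BSwap Γ Δ) :
      BTyping Γ M A → BTyping Δ (M.rename h.ren) A
  | lam {Γ : BCtx} {M : Lam} {B : BTy} (n : ℕ) (A : BTy) :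
      BTyping ((n, A) :: Γ) M B → BTyping Γ (Lam.lam M) (BTy.limp n A B)
  | app {Γ Δ Θ : BCtx} {M N : Lam} {B : BTy} (n : ℕ) (A : BTy) (h : BMerge Γ (Δ.scale n) Θ) :
      BTyping Γ M (BTy.limp n A B) → BTyping Δ N A →
        BTyping Θ (Lam.app (M.rename h.renL) (N.rename h.renR)) B

/-! ### The graded exponential comonad of bounded multisets -/

/-- `!ₙ X`: the multisets of cardinality at most `n`. -/
abbrev GBang (n : ℕ) (X : Type u) : Type u := {μ : Multiset X // μ.card ≤ n}

/-- The functor `!ₙ` on matrices. -/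
def gbang (n : ℕ) (f : Mat X Y) : Mat (GBang n X) (GBang n Y) := fun α β => bang f α.1 β.1

/-- The lax monoidal unit of `!ₙ`. -/
def gunit (n : ℕ) : Mat PUnit.{u + 1} (GBang n PUnit.{u + 1}) := fun _ _ => 0

/-- The lax monoidal product of `!ₙ`. -/
def gmul (n : ℕ) (X Y : Type u) : Mat (GBang n X × GBang n Y) (GBang n (X × Y)) := fun p γ =>
  ind (γ.1.map Prod.fst = p.1.1 ∧ γ.1.map Prod.snd = p.2.1)

/-- Weakening. -/
def gweak (X : Type u) : Mat (GBang 0 X) PUnit.{u + 1} := fun α _ => ind (α.1 = 0)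

/-- Contraction. -/
def gcontr (r s : ℕ) (X : Type u) : Mat (GBang (r + s) X) (GBang r X × GBang s X) := fun α p =>
  ind (α.1 = p.1.1 + p.2.1)

/-- Dereliction. -/
def gder (X : Type u) : Mat (GBang 1 X) X := fun α a => ind (α.1 = {a})

/-- Digging. -/
def gdig (r s : ℕ) (X : Type u) : Mat (GBang (r * s) X) (GBang r (GBang s X)) := fun α B =>
  ind (α.1 = (B.1.map Subtype.val).sum)

/-- Linear evaluation. -/
def lev (X Y : Type u) : Mat ((X × Y) × X) Y := fun p y => ind (p.1 = (p.2, y))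

/-- Interpretation of graded types, where the ground type is interpreted by the set `O`. -/
def BTy.Sem (O : Type u) : BTy → Type u
  | BTy.o => O
  | BTy.limp n A B => GBang n (A.Sem O) × B.Sem O

/-- Interpretation of graded contexts, as tensor products of the `!ₙ A`. -/
def BCtx.Sem (O : Type u) : BCtx → Type u
  | [] => PUnit
  | d :: Γ => GBang d.1 (d.2.Sem O) × BCtx.Sem O Γ

/-- The morphism `⟦nΓ⟧ ⟶ !ₙ ⟦Γ⟧` made of diggings and of the monoidal structure of `!ₙ`. -/
def BCtx.dig (O : Type u) (n : ℕ) :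
    (Γ : BCtx) → Mat (BCtx.Sem O (Γ.scale n)) (GBang n (BCtx.Sem O Γ))
  | [] => gunit n
  | d :: Γ => comp (gmul n (GBang d.1 (d.2.Sem O)) (BCtx.Sem O Γ))
      (tensor (gdig n d.1 (d.2.Sem O)) (BCtx.dig O n Γ))

/-- The morphism `⟦Γ + Δ⟧ ⟶ ⟦Γ⟧ ⊗ ⟦Δ⟧`, which contracts the common variables. -/
def BMerge.sem (O : Type u) : {Γ Δ Θ : BCtx} → BMerge Γ Δ Θ →
    Mat (BCtx.Sem O Θ) (BCtx.Sem O Γ × BCtx.Sem O Δ)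
  | _, _, _, BMerge.nil => fun _ _ => 0
  | _, _, _, BMerge.left _ h => fun χ p =>
      ind (χ.1 = p.1.1) + BMerge.sem O h χ.2 (p.1.2, p.2)
  | _, _, _, BMerge.right _ h => fun χ p =>
      ind (χ.1 = p.2.1) + BMerge.sem O h χ.2 (p.1, p.2.2)
  | _, _, _, BMerge.both m n A h => fun χ p =>
      gcontr m n (A.Sem O) χ.1 (p.1.1, p.2.1) + BMerge.sem O h χ.2 (p.1.2, p.2.2)

/-- The symmetry that interprets an exchange. -/
def BSwap.act (O : Type u) : {Γ Δ : BCtx} → BSwap Γ Δ → BCtx.Sem O Δ → BCtx.Sem O Γ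
  | _, _, BSwap.head _ _ _ => fun χ => (χ.2.1, χ.1, χ.2.2)
  | _, _, BSwap.tail _ h => fun χ => (χ.1, BSwap.act O h χ.2)

/-- Interpretation of the graded λ-calculus. -/
def BTyping.sem (O : Type u) : {Γ : BCtx} → {M : Lam} → {A : BTy} → BTyping Γ M A →
    Mat (BCtx.Sem O Γ) (A.Sem O)
  | _, _, _, BTyping.var A => fun χ a => gder (A.Sem O) χ.1 a
  | _, _, _, BTyping.weak B h => fun χ a =>
      gweak (B.Sem O) χ.1 PUnit.unit + BTyping.sem O h χ.2 a
  | _, _, _, BTyping.contr n m B h => fun χ a =>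
      ⨅ p : GBang n (B.Sem O) × GBang m (B.Sem O),
        (BTyping.sem O h (p.1, p.2, χ.2) a + gcontr n m (B.Sem O) χ.1 p)
  | _, _, _, BTyping.exch h M => fun χ a => BTyping.sem O M (h.act O χ) a
  | _, _, _, BTyping.lam _ _ h => fun χ p => BTyping.sem O h (p.1, χ) p.2
  | _, _, _, @BTyping.app _ Δ _ _ _ B n A h M N =>
      comp (lev (GBang n (A.Sem O)) (B.Sem O))
        (comp (tensor (BTyping.sem O M) (comp (gbang n (BTyping.sem O N)) (BCtx.dig O n Δ)))
          (h.sem O))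

/-- The disjoint union of the interpretations of the types of a graded context: the variables of
the function that interprets a term. -/
def BCtx.Vars (O : Type u) : BCtx → Type u
  | [] => PEmpty
  | d :: Γ => d.2.Sem O ⊕ BCtx.Vars O Γ

/-- The inclusion of `!_{n₁} X₁ × ⋯ × !_{nₖ} Xₖ` into `!(X₁ + ⋯ + Xₖ)`. -/
def BCtx.incl (O : Type u) : (Γ : BCtx) → BCtx.Sem O Γ → Multiset (BCtx.Vars O Γ)
  | [], _ => 0
  | _ :: Γ, χ => oplus χ.1.1 (BCtx.incl O Γ χ.2)

/-- The function `t^!` of a matrix `t` on `!_{n₁} X₁ × ⋯ × !_{nₖ} Xₖ`. -/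
def BCtx.toFun (O : Type u) {Γ : BCtx} (t : Mat (BCtx.Sem O Γ) Y) (x : BCtx.Vars O Γ → ℝ≥0∞)
    (b : Y) : ℝ≥0∞ :=
  ⨅ χ : BCtx.Sem O Γ, (dot (BCtx.incl O Γ χ) x + t χ b)

end Trop

end

namespace Trop

variable {X : Type u} {Y : Type v} {Z : Type w}

/-! ### Lipschitz properties of tropical power series -/

-- Everything is controlled by the degrees of monomials. The monomial `dot μ x + c` has Lipschitz
-- constant `μ.card`, and an infimum of functions with a common constant keeps it, so bounded degree
-- gives a Lipschitz function (`isLipschitz_iInf`).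
--
-- In the graded calculus over a finite `O` the index set of the infimum is itself finite, whatever
-- the term. In a resource term each differential consumes its argument exactly once, so degrees
-- add, and applying to `0` erases every entry that would still consult the argument
-- (`DegreeLE.kdiff`, `kapp_kzero`).
--
-- Local Lipschitzness holds for every tropical power series: where all coordinates are at least `η
-- > 0`, a monomial of degree above `N` costs at least `N * η`, which exceeds a local bound on the
-- function once `N` is large. Only degrees up to `N` matter there (`isLocallyLipschitz_toFun`).
--
-- The Taylor formula is proved on matrices. Application has the explicit form given by `kapp_le`
-- and `le_kapp`: an entry chooses a finite multiset of uses of the argument. Fixing these uses one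
-- by one is differentiating, which gives one inequality (`iInf_foldl_diff_le`); forcing uses can
-- only raise the cost, which gives the other (`kapp_le_foldl_diff`). Addition commutes with infima
-- in `[0,∞]`, so the formula passes to functions.

theorem le_add_ldist (r s : ℝ≥0∞) : r ≤ s + ldist r s :=
  le_add_tsub.trans (add_le_add le_rfl (le_max_left _ _))

theorem ldist_comm (r s : ℝ≥0∞) : ldist r s = ldist s r := max_comm _ _

theorem supDist_comm (x y : X → ℝ≥0∞) : supDist x y = supDist y x := by
  simp only [supDist, ldist_comm]

theorem ldist_le_iff {r s d : ℝ≥0∞} : ldist r s ≤ d ↔ r ≤ s + d ∧ s ≤ r + d := by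
  simp only [ldist, max_le_iff, tsub_le_iff_left]

theorem le_add_supDist (x y : X → ℝ≥0∞) (a : X) : x a ≤ y a + supDist x y :=
  (le_add_ldist _ _).trans (add_le_add le_rfl (le_iSup (fun a => ldist (x a) (y a)) a))

theorem dot_le_add (μ : Multiset X) {x y : X → ℝ≥0∞} {d : ℝ≥0∞} (h : ∀ a, x a ≤ y a + d) :
    dot μ x ≤ dot μ y + μ.card * d := by
  induction μ using Multiset.induction_on with
  | empty => simp [dot]
  | cons a μ ih =>
    simp only [dot, Multiset.map_cons, Multiset.sum_cons, Multiset.card_cons] at ih ⊢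
    refine (add_le_add (h a) ih).trans (le_of_eq ?_)
    push_cast
    ring

theorem card_mul_le_dot (μ : Multiset X) {x : X → ℝ≥0∞} {η : ℝ≥0∞} (h : ∀ a, η ≤ x a) :
    μ.card * η ≤ dot μ x := by
  induction μ using Multiset.induction_on with
  | empty => simp [dot]
  | cons a μ ih =>
    simp only [dot, Multiset.map_cons, Multiset.sum_cons, Multiset.card_cons] at ih ⊢
    refine le_trans (le_of_eq ?_) (add_le_add (h a) ih)
    push_cast
    ring

/-- An infimum of monomials of bounded degree is Lipschitz, with the degree bound as constant. -/
theorem isLipschitz_iInf {ι : Type*} (m : ι → Multiset X) (c : ι → ℝ≥0∞) (N : ℕ)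
    (h : ∀ i, c i ≠ ⊤ → (m i).card ≤ N) :
    IsLipschitz (fun x => ⨅ i, (dot (m i) x + c i)) := by
  have key : ∀ x y : X → ℝ≥0∞,
      (⨅ i, (dot (m i) x + c i)) ≤ (⨅ i, (dot (m i) y + c i)) + N * supDist x y := by
    intro x y
    rw [ENNReal.iInf_add]
    refine le_iInf fun i => (iInf_le _ i).trans ?_
    -- Monomials with infinite coefficient have no degree bound, but they contribute only `∞`.
    by_cases hc : c i = ⊤
    · simp [hc]
    · have hN : ((m i).card : ℝ≥0∞) ≤ N := by exact_mod_cast h i hc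
      calc dot (m i) x + c i ≤ (dot (m i) y + (m i).card * supDist x y) + c i := by
            gcongr
            exact dot_le_add _ (le_add_supDist x y)
        _ ≤ (dot (m i) y + N * supDist x y) + c i := by gcongr
        _ = _ := by ring
  refine ⟨N, fun x y => ldist_le_iff.2 ⟨by simpa using key x y, ?_⟩⟩
  rw [supDist_comm]
  simpa using key y x

/-- Lowering all coordinates of `x` by a finite `η < ε` stays in the ball, where coordinates are
positive, so `x` itself is bounded below by `η`. Halving `η` leaves room for a uniform lower bound
on a whole ball. -/
theorem exists_pos_le_of_mem_posInterior {x : X → ℝ≥0∞} (hx : x ∈ posInterior X) :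
    ∃ η : ℝ≥0∞, 0 < η ∧ η ≠ ⊤ ∧ ∀ y, supDist x y < η → ∀ a, η ≤ y a := by
  obtain ⟨ε, hε, h⟩ := hx
  obtain ⟨η, hη0, hη⟩ := ENNReal.lt_iff_exists_nnreal_btwn.1 hε
  have hpos : (0 : ℝ≥0∞) < η := hη0
  have hx : ∀ a, (η : ℝ≥0∞) ≤ x a := by
    intro a
    refine (tsub_pos_iff_lt.1 (h (fun a => x a - η) (lt_of_le_of_lt ?_ hη) a)).le
    refine iSup_le fun a => ldist_le_iff.2 ⟨le_tsub_add, tsub_le_self.trans le_self_add⟩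
  refine ⟨(η : ℝ≥0∞) / 2, ENNReal.half_pos hpos.ne',
    (ENNReal.half_le_self.trans_lt ENNReal.coe_lt_top).ne, fun y hy a => ?_⟩
  have h1 : (η : ℝ≥0∞) / 2 + η / 2 ≤ y a + η / 2 := by
    rw [ENNReal.add_halves]
    exact (hx a).trans ((le_add_supDist x y a).trans (by gcongr))
  exact (ENNReal.add_le_add_iff_right
    (ENNReal.half_le_self.trans_lt ENNReal.coe_lt_top).ne).1 h1

/-- On the interior of `(0,∞]^X` a tropical power series is locally given by the monomials of
bounded degree, hence it is locally Lipschitz. -/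
theorem isLocallyLipschitz_toFun (t : KMat X Y) (b : Y) :
    IsLocallyLipschitz (fun x => toFun t x b) := by
  intro x hx
  obtain ⟨η, hη, hηt, hball⟩ := exists_pos_le_of_mem_posInterior hx
  refine ⟨η, hη, ?_⟩
  -- If the function is `∞` on the whole ball, the constant `0` works because `|∞ - ∞| = 0`.
  by_cases hfin : ∃ y₀, supDist x y₀ < η ∧ toFun t y₀ b ≠ ⊤
  · obtain ⟨y₀, hy₀, hf⟩ := hfin
    obtain ⟨μ₀, hμ₀⟩ : ∃ μ₀, dot μ₀ y₀ + t μ₀ b ≠ ⊤ := by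
      by_contra! hcon
      exact hf (by simp [toFun, hcon])
    -- One monomial that is finite at `y₀` bounds the function on the ball, since any two of its
    -- points are within `η + η` of each other through `x`.
    set F : ℝ≥0∞ := dot μ₀ y₀ + t μ₀ b + μ₀.card * (η + η) with hF
    have hFt : F ≠ ⊤ := ENNReal.add_ne_top.2
      ⟨hμ₀, ENNReal.mul_ne_top (ENNReal.natCast_ne_top _) (ENNReal.add_ne_top.2 ⟨hηt, hηt⟩)⟩
    have hbound : ∀ y, supDist x y < η → toFun t y b ≤ F := by
      intro y hy
      refine (iInf_le _ μ₀).trans ?_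
      have : dot μ₀ y ≤ dot μ₀ y₀ + μ₀.card * (η + η) := by
        refine dot_le_add _ fun a => ?_
        calc y a ≤ x a + supDist y x := le_add_supDist y x a
          _ ≤ (y₀ a + supDist x y₀) + supDist y x := by
            gcongr
            exact le_add_supDist x y₀ a
          _ ≤ (y₀ a + η) + η := by
            rw [supDist_comm y x]
            gcongr
          _ = _ := by ring
      calc dot μ₀ y + t μ₀ b ≤ (dot μ₀ y₀ + μ₀.card * (η + η)) + t μ₀ b := by gcongr
        _ = F := by rw [hF]; ring
    -- Beyond degree `N` a monomial exceeds `F` on the ball, so it cannot improve the infimum.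
    obtain ⟨N, hN⟩ := ENNReal.exists_nat_mul_gt hη.ne' hFt
    have key : ∀ y z, supDist x y < η → supDist x z < η →
        toFun t y b ≤ toFun t z b + N * supDist y z := by
      intro y z hy hz
      simp only [toFun, ENNReal.iInf_add]
      refine le_iInf fun μ => ?_
      by_cases hμ : μ.card ≤ N
      · have hN : (μ.card : ℝ≥0∞) ≤ N := by exact_mod_cast hμ
        refine (iInf_le _ μ).trans ?_
        calc dot μ y + t μ b ≤ (dot μ z + μ.card * supDist y z) + t μ b := by
              gcongr
              exact dot_le_add _ (le_add_supDist y z)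
          _ ≤ (dot μ z + N * supDist y z) + t μ b := by gcongr
          _ = _ := by ring
      · have hN' : (N : ℝ≥0∞) ≤ μ.card := by exact_mod_cast (not_le.1 hμ).le
        calc toFun t y b ≤ F := hbound y hy
          _ ≤ N * η := hN.le
          _ ≤ μ.card * η := by gcongr
          _ ≤ dot μ z := card_mul_le_dot μ (hball z hz)
          _ ≤ _ := le_self_add.trans le_self_add
    refine ⟨N, fun y z hy hz => ldist_le_iff.2 ⟨by simpa using key y z hy hz, ?_⟩⟩
    rw [supDist_comm]
    simpa using key z y hz hy
  · push Not at hfin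
    refine ⟨0, fun y z hy hz => ?_⟩
    simp [hfin y hy, hfin z hz, ldist]

/-! ### The graded calculus -/

instance finite_gbang (n : ℕ) [Finite X] : Finite (GBang n X) := by
  let f : (Σ k : Fin (n + 1), (Fin k → X)) → GBang n X := fun p =>
    ⟨(List.ofFn p.2 : Multiset X), by simpa using Nat.lt_succ_iff.1 p.1.2⟩
  refine Finite.of_surjective f ?_
  rintro ⟨μ, hμ⟩
  induction μ using Quotient.inductionOn with
  | h l =>
    refine ⟨⟨⟨l.length, Nat.lt_succ_iff.2 (by simpa using hμ)⟩, l.get⟩, Subtype.ext ?_⟩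
    change ((List.ofFn l.get : List X) : Multiset X) = (l : Multiset X)
    rw [List.ofFn_get]

theorem BTy.finite_sem (O : Type u) [Finite O] : ∀ A : BTy, Finite (A.Sem O)
  | BTy.o => ‹Finite O›
  | BTy.limp n A B => by
    have := BTy.finite_sem O A
    have := BTy.finite_sem O B
    exact inferInstanceAs (Finite (GBang n (A.Sem O) × B.Sem O))

theorem BCtx.finite_sem (O : Type u) [Finite O] : ∀ Γ : BCtx, Finite (BCtx.Sem O Γ)
  | [] => inferInstanceAs (Finite PUnit)
  | d :: Γ => by
    have := BTy.finite_sem O d.2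
    have := BCtx.finite_sem O Γ
    exact inferInstanceAs (Finite (GBang d.1 (d.2.Sem O) × BCtx.Sem O Γ))

theorem BCtx.finite_vars (O : Type u) [Finite O] : ∀ Γ : BCtx, Finite (BCtx.Vars O Γ)
  | [] => inferInstanceAs (Finite PEmpty)
  | d :: Γ => by
    have := BTy.finite_sem O d.2
    have := BCtx.finite_vars O Γ
    exact inferInstanceAs (Finite (d.2.Sem O ⊕ BCtx.Vars O Γ))

theorem isTropicalPolynomial_iInf {ι : Type*} [Finite ι] [Finite X] (m : ι → Multiset X)
    (c : ι → ℝ≥0∞) : IsTropicalPolynomial (fun x => ⨅ i, (dot (m i) x + c i)) := by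
  classical
  -- As `m` need not be injective, the coefficient of `μ` collects the infimum of `c` over the fibre
  -- of `m`.
  refine ⟨inferInstance, (Set.finite_range m).toFinset,
    fun μ => ⨅ (i : ι) (_ : m i = μ), c i, fun x => le_antisymm ?_ ?_⟩
  · refine le_iInf₂ fun μ _ => ?_
    simp only [ENNReal.add_iInf]
    refine le_iInf₂ fun i hi => ?_
    subst hi
    exact iInf_le _ i
  · refine le_iInf fun i => (iInf₂_le (m i) (by simp)).trans ?_
    refine add_le_add le_rfl (iInf₂_le (f := fun (j : ι) (_ : m j = m i) => c j) i rfl)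

theorem exists_card_le {ι : Type*} [Finite ι] (m : ι → Multiset X) :
    ∃ N, ∀ i, (m i).card ≤ N := by
  obtain ⟨N, hN⟩ := (Set.finite_range fun i => (m i).card).bddAbove
  exact ⟨N, fun i => hN ⟨i, rfl⟩⟩

/-! ### Composition in the coKleisli category -/

theorem ind_of_true {p : Prop} (h : p) : ind p = 0 := by simp [ind, h]

theorem ind_of_false {p : Prop} (h : ¬p) : ind p = ⊤ := by simp [ind, h]

/-- A multiset of pairs records each use of `t` together with the inputs it consumes. With
`le_kcomp` this computes coKleisli composition as an infimum over such multisets; keeping two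
inequalities avoids asking that infima be attained. -/
theorem kcomp_le (s : KMat Y Z) (t : KMat X Y) (ρ : Multiset (Multiset X × Y)) (c : Z) :
    kcomp s t (ρ.map Prod.fst).sum c ≤
      s (ρ.map Prod.snd) c + (ρ.map fun p => t p.1 p.2).sum := by
  refine (iInf_le _ (ρ.map Prod.snd)).trans ?_
  gcongr
  refine (iInf_le _ (ρ.map Prod.fst)).trans ?_
  rw [dig, ind_of_true rfl, add_zero]
  exact iInf₂_le ρ ⟨rfl, rfl⟩

theorem le_kcomp {s : KMat Y Z} {t : KMat X Y} {μ : Multiset X} {c : Z} {C : ℝ≥0∞}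
    (h : ∀ ρ : Multiset (Multiset X × Y), (ρ.map Prod.fst).sum = μ →
      C ≤ s (ρ.map Prod.snd) c + (ρ.map fun p => t p.1 p.2).sum) :
    C ≤ kcomp s t μ c := by
  simp only [kcomp, comp, bang, ENNReal.add_iInf, ENNReal.iInf_add]
  refine le_iInf fun β => le_iInf fun B => le_iInf₂ fun ρ hρ => ?_
  obtain ⟨rfl, rfl⟩ := hρ
  by_cases hd : μ = (ρ.map Prod.fst).sum
  · rw [dig, ind_of_true hd, add_zero]
    exact h ρ hd.symm
  · simp [dig, ind_of_false hd]

theorem forall_of_sum_ind_ne_top {ι : Type*} {P : ι → Prop} {ρ : Multiset ι}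
    (h : (ρ.map fun p => ind (P p)).sum ≠ ⊤) : ∀ p ∈ ρ, P p := by
  intro p hp
  by_contra hP
  refine h (top_le_iff.1 ?_)
  rw [← ind_of_false hP]
  exact Multiset.single_le_sum (fun _ _ => zero_le) _
    (Multiset.mem_map_of_mem (fun p => ind (P p)) hp)

theorem sum_ind_eq_zero {ι : Type*} {P : ι → Prop} {ρ : Multiset ι}
    (h : ∀ p ∈ ρ, P p) : (ρ.map fun p => ind (P p)).sum = 0 := by
  refine Multiset.sum_eq_zero fun y hy => ?_
  obtain ⟨p, hp, rfl⟩ := Multiset.mem_map.1 hy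
  exact ind_of_true (h p hp)

theorem sum_map_fst_of_forall {g : Y → X} {ρ : Multiset (Multiset X × Y)}
    (h : ∀ p ∈ ρ, p.1 = {g p.2}) : (ρ.map Prod.fst).sum = (ρ.map Prod.snd).map g := by
  rw [Multiset.map_congr rfl h, ← Multiset.sum_map_singleton ((ρ.map Prod.snd).map g),
    Multiset.map_map, Multiset.map_map]
  rfl

/-- Each use of the projection consumes one singleton, at cost `0`. With `le_kcomp_kfst`, weakening
is reindexing along `Sum.inl`. -/
theorem kcomp_kfst_le (t : KMat X Z) (ρ : Multiset X) (c : Z) :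
    kcomp t (kfst X Y) (ρ.map Sum.inl) c ≤ t ρ c := by
  have h := kcomp_le t (kfst X Y) (ρ.map fun a => ({Sum.inl a}, a)) c
  rw [sum_map_fst_of_forall (g := Sum.inl) (by simp)] at h
  simpa [Multiset.map_map, kfst, ind] using h

theorem le_kcomp_kfst {t : KMat X Z} {μ : Multiset (X ⊕ Y)} {c : Z} {C : ℝ≥0∞}
    (h : ∀ ρ : Multiset X, μ = ρ.map Sum.inl → C ≤ t ρ c) :
    C ≤ kcomp t (kfst X Y) μ c := by
  refine le_kcomp fun ρ hρ => ?_
  by_cases hs : (ρ.map fun p => kfst X Y p.1 p.2).sum = ⊤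
  · simp [hs]
  · have hall := forall_of_sum_ind_ne_top hs
    refine (h _ ?_).trans le_self_add
    rw [← hρ, sum_map_fst_of_forall hall]

/-! ### Multisets on disjoint unions -/

theorem oplus_add_inr (μ : Multiset X) (ν : Multiset Y) (b : Y) :
    oplus μ ν + {Sum.inr b} = oplus μ (b ::ₘ ν) := by
  rw [oplus, oplus, Multiset.map_cons, ← Multiset.singleton_add, add_assoc, add_comm {Sum.inr b}]

theorem card_oplus (μ : Multiset X) (ν : Multiset Y) :
    (oplus μ ν).card = μ.card + ν.card := by
  simp [oplus]

theorem filterMap_getLeft_oplus (μ : Multiset X) (ν : Multiset Y) :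
    (oplus μ ν).filterMap Sum.getLeft? = μ := by
  induction μ, ν using Quotient.inductionOn₂ with
  | h l m =>
    change ((List.filterMap Sum.getLeft? (l.map Sum.inl ++ m.map Sum.inr) : List X) : Multiset X)
      = (l : Multiset X)
    congr 1
    rw [List.filterMap_append, List.filterMap_map, List.filterMap_map]
    simp [Function.comp_def]

theorem filterMap_getRight_oplus (μ : Multiset X) (ν : Multiset Y) :
    (oplus μ ν).filterMap Sum.getRight? = ν := by
  induction μ, ν using Quotient.inductionOn₂ with
  | h l m =>
    change ((List.filterMap Sum.getRight? (l.map Sum.inl ++ m.map Sum.inr) : List Y) : Multiset Y)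
      = (m : Multiset Y)
    congr 1
    rw [List.filterMap_append, List.filterMap_map, List.filterMap_map]
    simp [Function.comp_def]

theorem exists_eq_oplus (ν : Multiset (X ⊕ Y)) : ∃ μ ρ, ν = oplus μ ρ := by
  induction ν using Multiset.induction_on with
  | empty => exact ⟨0, 0, rfl⟩
  | cons e ν ih =>
    obtain ⟨μ, ρ, rfl⟩ := ih
    cases e with
    | inl a => exact ⟨a ::ₘ μ, ρ, by simp [oplus]⟩
    | inr b => exact ⟨μ, b ::ₘ ρ, by simp [oplus]⟩

theorem oplus_injective {μ μ' : Multiset X} {ν ν' : Multiset Y}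
    (h : oplus μ ν = oplus μ' ν') : μ = μ' ∧ ν = ν' :=
  ⟨by rw [← filterMap_getLeft_oplus μ ν, h, filterMap_getLeft_oplus],
    by rw [← filterMap_getRight_oplus μ ν, h, filterMap_getRight_oplus]⟩

/-- Lifts second components through `g`, which need not be injective: each element of `r` is peeled
off together with a pair of `ρ` lying over its image. -/
theorem exists_map_of_map_snd_eq {W : Type*} (g : Y → Z) (r : Multiset Y)
    (ρ : Multiset (W × Z)) (h : ρ.map Prod.snd = r.map g) :
    ∃ τ : Multiset (W × Y), ρ = τ.map (Prod.map id g) ∧ τ.map Prod.snd = r := by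
  classical
  induction r using Multiset.induction_on generalizing ρ with
  | empty => exact ⟨0, by simpa using h, rfl⟩
  | cons y r ih =>
    rw [Multiset.map_cons] at h
    obtain ⟨p, hp, hpy, he⟩ := (Multiset.map_eq_cons _ _ _ _).2 h
    obtain ⟨τ, hτ, rfl⟩ := ih _ he
    refine ⟨(p.1, y) ::ₘ τ, ?_, by simp⟩
    rw [Multiset.map_cons, ← hτ, ← Multiset.cons_erase hp]
    simp [← hpy]

/-- Splitting of a multiset of pairs whose second components contain exactly one `inl`. -/
theorem exists_cons_of_map_snd_eq {W : Type*} {ρ : Multiset (W × (X ⊕ Y))} {a : X}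
    {r : Multiset Y} (h : ρ.map Prod.snd = oplus {a} r) :
    ∃ (w : W) (τ : Multiset (W × Y)),
      ρ = (w, Sum.inl a) ::ₘ τ.map (Prod.map id Sum.inr) ∧ τ.map Prod.snd = r := by
  classical
  rw [oplus, Multiset.map_singleton, Multiset.singleton_add] at h
  obtain ⟨p, hp, hpa, he⟩ := (Multiset.map_eq_cons _ _ _ _).2 h
  obtain ⟨τ, hτ, hr⟩ := exists_map_of_map_snd_eq _ _ _ he
  refine ⟨p.1, τ, ?_, hr⟩
  rw [← hτ, ← hpa, Multiset.cons_erase hp]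

/-! ### Application, uncurrying and differentiation -/

/-- Evaluation costs `0` exactly when it uses the function once, at some `(r, b)`, and the argument
at the elements of `r`. With `le_kapp` this is the formula for application: one run of `M` and one
run of `N` for each use. -/
theorem kapp_le (M : KMat Z (Multiset X × Y)) (N : KMat Z X) (μ : Multiset Z)
    (ρ : Multiset (Multiset Z × X)) (b : Y) :
    kcomp (kev X Y) (kpair M N) (μ + (ρ.map Prod.fst).sum) b ≤
      M μ (ρ.map Prod.snd, b) + (ρ.map fun p => N p.1 p.2).sum := by
  have h := kcomp_le (kev X Y) (kpair M N)
    ((μ, Sum.inl (ρ.map Prod.snd, b)) ::ₘ ρ.map (Prod.map id Sum.inr)) b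
  simp only [Multiset.map_cons, Multiset.map_map, Multiset.sum_cons, Function.comp_def,
    Prod.map_fst, Prod.map_snd, id, kpair, Sum.elim_inl, Sum.elim_inr] at h
  rw [kev, ind_of_true ⟨ρ.map Prod.snd, by simp [oplus, Multiset.map_map]⟩, zero_add] at h
  exact h

theorem le_kapp {M : KMat Z (Multiset X × Y)} {N : KMat Z X} {ν : Multiset Z} {b : Y} {C : ℝ≥0∞}
    (h : ∀ (μ : Multiset Z) (ρ : Multiset (Multiset Z × X)), ν = μ + (ρ.map Prod.fst).sum →
      C ≤ M μ (ρ.map Prod.snd, b) + (ρ.map fun p => N p.1 p.2).sum) :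
    C ≤ kcomp (kev X Y) (kpair M N) ν b := by
  refine le_kcomp fun τ hτ => ?_
  by_cases he : ∃ r : Multiset X, τ.map Prod.snd = oplus {(r, b)} r
  · obtain ⟨r, hr⟩ := he
    obtain ⟨μ, ρ, rfl, rfl⟩ := exists_cons_of_map_snd_eq hr
    refine le_trans ?_ le_add_self
    simp only [Multiset.map_cons, Multiset.map_map, Multiset.sum_cons, Function.comp_def,
      Prod.map_fst, Prod.map_snd, id, kpair, Sum.elim_inl, Sum.elim_inr] at hτ ⊢
    exact h μ ρ hτ.symm
  · simp [kev, ind_of_false he]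

theorem kuncurry_le (t : KMat Z (Multiset X × Y)) (ρ : Multiset Z) (p : Multiset X) (b : Y) :
    kuncurry t (oplus ρ p) b ≤ t ρ (p, b) := by
  have h := kapp_le (kcomp t (kfst Z X)) (ksnd Z X) (ρ.map Sum.inl)
    (p.map fun a => ({Sum.inr a}, a)) b
  rw [sum_map_fst_of_forall (g := Sum.inr) (by simp)] at h
  simp only [Multiset.map_map, Function.comp_def, ksnd, Multiset.map_id'] at h
  rw [sum_ind_eq_zero (by simp), add_zero] at h
  exact h.trans (kcomp_kfst_le _ _ _)

theorem le_kuncurry (t : KMat Z (Multiset X × Y)) (ρ : Multiset Z) (p : Multiset X) (b : Y) :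
    t ρ (p, b) ≤ kuncurry t (oplus ρ p) b := by
  refine le_kapp fun μ τ hμ => ?_
  by_cases hs : (τ.map fun q => ksnd Z X q.1 q.2).sum = ⊤
  · simp [hs]
  · rw [sum_map_fst_of_forall (forall_of_sum_ind_ne_top hs)] at hμ
    refine le_trans (le_kcomp_kfst fun r hr => ?_) le_self_add
    obtain ⟨rfl, rfl⟩ := oplus_injective (hμ.trans (by rw [hr]; rfl) : _ = oplus r _)
    exact le_rfl

theorem kuncurry_oplus (t : KMat Z (Multiset X × Y)) (ρ : Multiset Z) (p : Multiset X) (b : Y) :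
    kuncurry t (oplus ρ p) b = t ρ (p, b) :=
  le_antisymm (kuncurry_le t ρ p b) (le_kuncurry t ρ p b)

theorem kD_oplus_singleton (t : KMat X Y) (a : X) (ρ : Multiset X) (b : Y) :
    kD t (oplus {a} ρ) b = t (ρ + {a}) b := by
  simp [kD, filterMap_getLeft_oplus, filterMap_getRight_oplus]

/-- The derivative uses its linear argument once. Its direction is `(0, s)`, so that use must lie in
the `X` component and is produced by `s`; all other uses come from the identity. -/
theorem kstar_le (u : KMat (Z ⊕ X) Y) (s : KMat Z X) (μ ν : Multiset Z) (p : Multiset X) (a : X)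
    (b : Y) : kstar u s (oplus (μ + ν) p) b ≤ u (oplus μ (a ::ₘ p)) b + s ν a := by
  have h := kcomp_le (kD u)
    (kpair (kpair (kzero (Z ⊕ X) Z) (kcomp s (kfst Z X))) (der (Z ⊕ X)))
    ((ν.map Sum.inl, Sum.inl (Sum.inr a)) ::ₘ (oplus μ p).map fun z => ({z}, Sum.inr z)) b
  simp only [Multiset.map_cons, Multiset.map_map, Multiset.sum_cons, Function.comp_def,
    kpair, Sum.elim_inl, Sum.elim_inr, der] at h
  rw [sum_ind_eq_zero (by simp), add_zero, Multiset.sum_map_singleton] at h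
  have h1 : ν.map Sum.inl + oplus μ p = oplus (μ + ν) p := by
    simp only [oplus, Multiset.map_add]
    abel
  have h2 : Sum.inl (Sum.inr a) ::ₘ (oplus μ p).map Sum.inr
      = oplus {(Sum.inr a : Z ⊕ X)} (oplus μ p) := by
    simp [oplus]
  rw [h1, h2, kD_oplus_singleton, oplus_add_inr] at h
  exact h.trans (add_le_add le_rfl (kcomp_kfst_le _ _ _))

theorem le_kstar {u : KMat (Z ⊕ X) Y} {s : KMat Z X} {ρ : Multiset Z} {p : Multiset X} {b : Y}
    {C : ℝ≥0∞} (h : ∀ (μ ν : Multiset Z) (a : X), ρ = μ + ν →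
      C ≤ u (oplus μ (a ::ₘ p)) b + s ν a) :
    C ≤ kstar u s (oplus ρ p) b := by
  refine le_kcomp fun τ hτ => ?_
  obtain ⟨e, r, hr⟩ := exists_eq_oplus (τ.map Prod.snd)
  rw [hr]
  by_cases he : e.card = 1
  · obtain ⟨e, rfl⟩ := Multiset.card_eq_one.1 he
    obtain ⟨ν, τ, rfl, rfl⟩ := exists_cons_of_map_snd_eq hr
    rw [kD_oplus_singleton]
    simp only [Multiset.map_cons, Multiset.map_map, Multiset.sum_cons, Function.comp_def,
      Prod.map_fst, Prod.map_snd, id, kpair, Sum.elim_inl, Sum.elim_inr] at hτ ⊢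
    cases e with
    | inl z => simp [kzero]
    | inr a =>
      by_cases hs : (τ.map fun q => der (Z ⊕ X) q.1 q.2).sum = ⊤
      · simp [hs]
      · rw [sum_map_fst_of_forall (g := id) (forall_of_sum_ind_ne_top hs), Multiset.map_id] at hτ
        refine le_trans ?_ (add_le_add le_rfl le_self_add)
        -- Moving the other summand to the left by truncated subtraction isolates the composite, so
        -- that its lower bound lemma applies, even if that summand is `∞`.
        rw [← tsub_le_iff_left]
        refine le_kcomp_kfst fun ν' hν' => ?_
        rw [tsub_le_iff_left]
        obtain ⟨μ, p', hμ⟩ := exists_eq_oplus (τ.map Prod.snd)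
        have hsum : oplus (ν' + μ) p' = oplus ρ p := by
          rw [← hτ, hμ, hν', oplus, oplus, Multiset.map_add, add_assoc]
        obtain ⟨rfl, rfl⟩ := oplus_injective hsum
        rw [hμ, oplus_add_inr]
        exact h μ ν' a (add_comm _ _)
  · simp [kD, filterMap_getLeft_oplus, he]

/-- The interpretation of `D[M, N]`. -/
noncomputable def kdiff (M : KMat Z (Multiset X × Y)) (N : KMat Z X) : KMat Z (Multiset X × Y) :=
  kcurry (kstar (kuncurry M) N)

/-- With `le_kdiff`, an entry of `D[M, N]` is the infimum over splittings of the context between `M`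
and a single run of `N`, which supplies one element of the argument multiset. -/
theorem kdiff_le (M : KMat Z (Multiset X × Y)) (N : KMat Z X) (μ ν : Multiset Z)
    (p : Multiset X) (a : X) (b : Y) :
    kdiff M N (μ + ν) (p, b) ≤ M μ (a ::ₘ p, b) + N ν a := by
  rw [← kuncurry_oplus M]
  exact kstar_le _ _ _ _ _ _ _

theorem le_kdiff {M : KMat Z (Multiset X × Y)} {N : KMat Z X} {ρ : Multiset Z}
    {p : Multiset X} {b : Y} {C : ℝ≥0∞} (h : ∀ (μ ν : Multiset Z) (a : X), ρ = μ + ν →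
      C ≤ M μ (a ::ₘ p, b) + N ν a) : C ≤ kdiff M N ρ (p, b) := by
  refine le_kstar fun μ ν a hρ => ?_
  rw [kuncurry_oplus]
  exact h μ ν a hρ

/-- Any use of the argument `0` costs `∞`, so only the empty argument multiset survives. -/
theorem kapp_kzero (M : KMat Z (Multiset X × Y)) (μ : Multiset Z) (b : Y) :
    kcomp (kev X Y) (kpair M (kzero Z X)) μ b = M μ (0, b) := by
  refine le_antisymm (by simpa using kapp_le M (kzero Z X) μ 0 b) (le_kapp fun ν ρ hμ => ?_)
  induction ρ using Multiset.induction_on with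
  | empty => simp [hμ]
  | cons q ρ _ => simp [kzero]

/-! ### Degree bounds for resource terms -/

/-- All the monomials of `t` have degree at most `N`. -/
def DegreeLE (t : KMat X Y) (N : ℕ) : Prop := ∀ μ b, t μ b ≠ ⊤ → μ.card ≤ N

theorem DegreeLE.isLipschitz {t : KMat X Y} {N : ℕ} (h : DegreeLE t N) (b : Y) :
    IsLipschitz (fun x => toFun t x b) :=
  isLipschitz_iInf id (fun μ => t μ b) N fun μ hμ => h μ b hμ

theorem DegreeLE.kcurry {t : KMat (Z ⊕ X) Y} {N : ℕ} (h : DegreeLE t N) :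
    DegreeLE (kcurry t) N := by
  intro μ b hb
  have := h _ _ hb
  rw [card_oplus] at this
  omega

/-- Degrees add because `N` runs exactly once; in an ordinary application it may run arbitrarily
often. -/
theorem DegreeLE.kdiff {M : KMat Z (Multiset X × Y)} {N : KMat Z X} {m n : ℕ}
    (hM : DegreeLE M m) (hN : DegreeLE N n) : DegreeLE (kdiff M N) (m + n) := by
  rintro μ ⟨p, b⟩ hb
  by_contra hcard
  -- The lower bound is taken to be `∞`: if the total degree is too large, one of the two entries is
  -- infinite in every splitting.
  refine hb (top_le_iff.1 (le_kdiff fun ν ν' a hμ => ?_))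
  by_contra hne
  obtain ⟨h1, h2⟩ := ENNReal.add_ne_top.1 fun h => hne h.ge
  have h1 := hM _ _ h1
  have h2 := hN _ _ h2
  rw [hμ, Multiset.card_add] at hcard
  omega

theorem DegreeLE.kapp_kzero {M : KMat Z (Multiset X × Y)} {N : ℕ} (h : DegreeLE M N) :
    DegreeLE (kcomp (kev X Y) (kpair M (kzero Z X))) N := by
  intro μ b hb
  rw [Trop.kapp_kzero] at hb
  exact h _ _ hb

theorem degreeLE_ksnd : DegreeLE (ksnd X Y) 1 := by
  intro μ b hb
  by_contra hcard
  refine hb (ind_of_false ?_)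
  rintro rfl
  simp at hcard

theorem DegreeLE.kcomp_kfst {t : KMat X Z} {N : ℕ} (h : DegreeLE t N) :
    DegreeLE (kcomp t (kfst X Y)) N := by
  intro μ b hb
  by_contra hcard
  refine hb (top_le_iff.1 (le_kcomp_kfst fun ρ hρ => ?_))
  by_contra hne
  have := h ρ b fun h => hne h.ge
  rw [hρ, Multiset.card_map] at hcard
  exact hcard this

theorem Var.degreeLE_sem (O : Type u) : ∀ {Γ : Ctx} {A : Ty} (x : Var Γ A), DegreeLE (x.sem O) 1
  | _, _, Var.zero => degreeLE_ksnd
  | _, _, Var.succ x => (Var.degreeLE_sem O x).kcomp_kfst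

theorem exists_degreeLE_foldl_diff (O : Type u) {Γ : Ctx} {A B : Ty} (us : List (DTm Γ A))
    (hus : ∀ u ∈ us, ∃ N, DegreeLE (u.sem O) N) (t : DTm Γ (Ty.arr A B))
    (ht : ∃ N, DegreeLE (t.sem O) N) :
    ∃ N, DegreeLE ((us.foldl DTm.diff t).sem O) N := by
  induction us generalizing t with
  | nil => exact ht
  | cons u us ih =>
    refine ih (fun v hv => hus v (List.mem_cons_of_mem _ hv)) _ ?_
    obtain ⟨m, hm⟩ := ht
    obtain ⟨n, hn⟩ := hus u List.mem_cons_self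
    exact ⟨m + n, hm.kdiff hn⟩

theorem Tm.exists_degreeLE_of_mem_taylor (O : Type u) : ∀ {Γ : Ctx} {A : Ty} (M : Tm Γ A),
    ∀ t ∈ M.taylor, ∃ N, DegreeLE (t.sem O) N
  | _, _, Tm.var x => by
    rintro t rfl
    exact ⟨1, x.degreeLE_sem O⟩
  | _, _, Tm.lam M => by
    rintro s ⟨t, ht, rfl⟩
    obtain ⟨N, hN⟩ := Tm.exists_degreeLE_of_mem_taylor O M t ht
    exact ⟨N, hN.kcurry⟩
  | _, _, Tm.app M N => by
    rintro s ⟨t, ht, us, hus, rfl⟩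
    obtain ⟨n, hn⟩ := exists_degreeLE_foldl_diff O us
      (fun u hu => Tm.exists_degreeLE_of_mem_taylor O N u (hus u hu)) t
      (Tm.exists_degreeLE_of_mem_taylor O M t ht)
    exact ⟨n, hn.kapp_kzero⟩

/-! ### The Taylor formula -/

theorem kapp_mono {M M' : KMat Z (Multiset X × Y)} {N N' : KMat Z X} (hM : M ≤ M') (hN : N ≤ N') :
    kcomp (kev X Y) (kpair M N) ≤ kcomp (kev X Y) (kpair M' N') := by
  intro ν b
  refine le_kapp fun μ ρ hν => ?_
  subst hν
  refine (kapp_le M N μ ρ b).trans (add_le_add (hM _ _) ?_)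
  exact Multiset.sum_map_le_sum_map _ _ fun p _ => hN _ _

/-- Differentiating along the argument itself forces at least one use of it. Each choice on the
right becomes a choice on the left by adding the forced use to `ρ`. -/
theorem kapp_le_kapp_kdiff (M : KMat Z (Multiset X × Y)) (N : KMat Z X) :
    kcomp (kev X Y) (kpair M N) ≤ kcomp (kev X Y) (kpair (kdiff M N) N) := by
  intro ν b
  refine le_kapp fun μ ρ hν => ?_
  rw [← tsub_le_iff_right]
  refine le_kdiff fun μ' ν' a hμ => ?_
  rw [tsub_le_iff_right]
  have h := kapp_le M N μ' ((ν', a) ::ₘ ρ) b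
  simp only [Multiset.map_cons, Multiset.sum_cons, ← add_assoc] at h
  rwa [hν, hμ]

theorem kdiff_mono_right (M : KMat Z (Multiset X × Y)) {N N' : KMat Z X} (hN : N ≤ N') :
    kdiff M N ≤ kdiff M N' := by
  rintro ν ⟨p, b⟩
  refine le_kdiff fun μ ν' a h => ?_
  subst h
  exact (kdiff_le M N μ ν' p a b).trans (add_le_add le_rfl (hN _ _))

/-- Forcing the uses one at a time only raises the cost, and so does replacing the remaining
argument by `0`, whose matrix is `∞`. -/
theorem kapp_le_foldl_diff (O : Type u) {Γ : Ctx} {A B : Ty}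
    (N : KMat (Ctx.Sem O Γ) (A.Sem O)) (us : List (DTm Γ A))
    (hus : ∀ u ∈ us, N ≤ u.sem O) (t : DTm Γ (Ty.arr A B)) :
    kcomp (kev (A.Sem O) (B.Sem O)) (kpair (t.sem O) N) ≤ (DTm.rapp t us).sem O := by
  induction us generalizing t with
  | nil => exact kapp_mono le_rfl fun _ _ => le_top
  | cons u us ih =>
    refine le_trans ?_ (ih (fun v hv => hus v (List.mem_cons_of_mem _ hv)) (DTm.diff t u))
    exact (kapp_le_kapp_kdiff _ N).trans
      (kapp_mono (kdiff_mono_right _ (hus u List.mem_cons_self)) le_rfl)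

theorem Tm.sem_le_of_mem_taylor (O : Type u) : ∀ {Γ : Ctx} {A : Ty} (M : Tm Γ A),
    ∀ t ∈ M.taylor, M.sem O ≤ t.sem O
  | _, _, Tm.var x => by
    rintro t rfl
    exact le_rfl
  | _, _, Tm.lam M => by
    rintro s ⟨t, ht, rfl⟩
    exact fun μ p => Tm.sem_le_of_mem_taylor O M t ht _ _
  | _, _, Tm.app M N => by
    rintro s ⟨t, ht, us, hus, rfl⟩
    exact (kapp_mono (Tm.sem_le_of_mem_taylor O M t ht) le_rfl).trans
      (kapp_le_foldl_diff O _ us (fun u hu => Tm.sem_le_of_mem_taylor O N u (hus u hu)) t)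

/-- For each use in `ρ` a term `u ∈ T` is chosen independently, giving the list of differentials.
Differentiating by `u` moves that use's inputs into the context and removes its output from the
argument multiset, which ends empty. The head changes at each step, hence the generality in `t` and
`μ`. -/
theorem iInf_foldl_diff_le (O : Type u) {Γ : Ctx} {A B : Ty} (T : Set (DTm Γ A))
    (b : B.Sem O) (ρ : Multiset (Multiset (Ctx.Sem O Γ) × A.Sem O)) (t : DTm Γ (Ty.arr A B))
    (μ : Multiset (Ctx.Sem O Γ)) :
    (⨅ (us : List (DTm Γ A)) (_ : ∀ u ∈ us, u ∈ T),
        (us.foldl DTm.diff t).sem O (μ + (ρ.map Prod.fst).sum) ((0 : Multiset (A.Sem O)), b)) ≤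
      t.sem O μ (ρ.map Prod.snd, b) + (ρ.map fun p => ⨅ u ∈ T, u.sem O p.1 p.2).sum := by
  induction ρ using Multiset.induction_on generalizing t μ with
  | empty =>
    refine (iInf₂_le [] (by simp)).trans ?_
    simp
  | cons p ρ ih =>
    simp only [Multiset.map_cons, Multiset.sum_cons, ENNReal.iInf_add, ENNReal.add_iInf]
    refine le_iInf₂ fun u hu => ?_
    have hd := kdiff_le (t.sem O) (u.sem O) μ p.1 (ρ.map Prod.snd) p.2 b
    rw [← add_assoc, ← add_assoc]
    refine le_trans ?_ ((ih (DTm.diff t u) (μ + p.1)).trans (add_le_add hd le_rfl))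
    refine le_iInf₂ fun us hus => iInf₂_le (u :: us) ?_
    simpa using ⟨hu, hus⟩

theorem Tm.iInf_taylor_le (O : Type u) : ∀ {Γ : Ctx} {A : Ty} (M : Tm Γ A)
    (μ : Multiset (Ctx.Sem O Γ)) (a : A.Sem O), (⨅ t ∈ M.taylor, t.sem O μ a) ≤ M.sem O μ a
  | _, _, Tm.var x => fun μ a =>
    iInf₂_le (f := fun t (_ : t ∈ (Tm.var x).taylor) => DTm.sem O t μ a) (DTm.var x) rfl
  | _, _, Tm.lam M => fun μ p => by
    refine le_trans ?_ (Tm.iInf_taylor_le O M (oplus μ p.1) p.2)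
    exact le_iInf₂ fun t ht => iInf₂_le (DTm.lam t) ⟨t, ht, rfl⟩
  | _, _, Tm.app M N => fun ν b => by
    refine le_kapp fun μ ρ hν => ?_
    subst hν
    refine le_trans ?_ (add_le_add (Tm.iInf_taylor_le O M _ _)
      (Multiset.sum_map_le_sum_map _ _ fun p _ => Tm.iInf_taylor_le O N p.1 p.2))
    simp only [ENNReal.iInf_add]
    refine le_iInf₂ fun t ht => ?_
    refine le_trans ?_ (iInf_foldl_diff_le O N.taylor b ρ t μ)
    refine le_iInf₂ fun us hus => (iInf₂_le (DTm.rapp t us) ⟨t, ht, us, hus, rfl⟩).trans ?_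
    exact (kapp_kzero _ _ _).le

theorem Tm.sem_eq_iInf_taylor (O : Type u) {Γ : Ctx} {A : Ty} (M : Tm Γ A)
    (μ : Multiset (Ctx.Sem O Γ)) (a : A.Sem O) :
    M.sem O μ a = ⨅ t ∈ M.taylor, t.sem O μ a :=
  le_antisymm (le_iInf₂ fun t ht => M.sem_le_of_mem_taylor O t ht μ a) (M.iInf_taylor_le O μ a)

theorem Tm.toFun_sem_eq_iInf_taylor (O : Type u) {Γ : Ctx} {A : Ty} (M : Tm Γ A) (a : A.Sem O)
    (x : Ctx.Sem O Γ → ℝ≥0∞) :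
    toFun (M.sem O) x a = ⨅ t ∈ M.taylor, toFun (t.sem O) x a := by
  simp only [toFun, M.sem_eq_iInf_taylor, ENNReal.add_iInf]
  rw [iInf_comm]
  exact iInf_congr fun t => iInf_comm

end Trop

theorem mainTheorem1 (O : Type*) :
    -- the graded calculus, over a finite ground set
    (Finite O → ∀ (Γ : Trop.BCtx) (M : Trop.Lam) (A : Trop.BTy) (d : Trop.BTyping Γ M A)
      (a : A.Sem O),
      Trop.IsTropicalPolynomial (fun x => Trop.BCtx.toFun O (d.sem O) x a) ∧
      Trop.IsLipschitz (fun x => Trop.BCtx.toFun O (d.sem O) x a)) ∧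
    -- resource terms in a Taylor expansion
    (∀ (Γ : Trop.Ctx) (A : Trop.Ty) (M : Trop.Tm Γ A), ∀ t ∈ M.taylor, ∀ a : A.Sem O,
      Trop.IsLipschitz (fun x => Trop.toFun (t.sem O) x a)) ∧
    -- the simply typed λ-calculus and PCF with tropical scalars
    ((∀ (Γ : Trop.Ctx) (A : Trop.Ty) (M : Trop.Tm Γ A) (a : A.Sem O),
      Trop.IsLocallyLipschitz (fun x => Trop.toFun (M.sem O) x a)) ∧
     (∀ (Γ : Trop.Ctx) (A : Trop.Ty) (M : Trop.PTm Γ A) (a : A.Sem ℕ),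
      Trop.IsLocallyLipschitz (fun x => Trop.toFun M.sem x a))) ∧
    -- the Taylor expansion decomposes a simply typed term as an infimum of Lipschitz functions
    (∀ (Γ : Trop.Ctx) (A : Trop.Ty) (M : Trop.Tm Γ A) (a : A.Sem O),
      (∀ t ∈ M.taylor, Trop.IsLipschitz (fun x => Trop.toFun (t.sem O) x a)) ∧
      ∀ x : Trop.Ctx.Sem O Γ → ENNReal,
        Trop.toFun (M.sem O) x a = ⨅ t ∈ M.taylor, Trop.toFun (t.sem O) x a) := by
  have lipschitz_taylor : ∀ (Γ : Trop.Ctx) (A : Trop.Ty) (M : Trop.Tm Γ A), ∀ t ∈ M.taylor,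
      ∀ a : A.Sem O, Trop.IsLipschitz (fun x => Trop.toFun (t.sem O) x a) := by
    intro Γ A M t ht a
    obtain ⟨N, hN⟩ := M.exists_degreeLE_of_mem_taylor O t ht
    exact hN.isLipschitz a
  refine ⟨fun hO Γ M A d a => ?_, lipschitz_taylor,
    ⟨fun Γ A M a => Trop.isLocallyLipschitz_toFun _ a,
      fun Γ A M a => Trop.isLocallyLipschitz_toFun _ a⟩,
    fun Γ A M a => ⟨fun t ht => lipschitz_taylor Γ A M t ht a, M.toFun_sem_eq_iInf_taylor O a⟩⟩
  have := Trop.BCtx.finite_sem O Γ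
  have := Trop.BCtx.finite_vars O Γ
  -- Finiteness of the index set alone bounds the degrees; the entries of the matrix play no role.
  obtain ⟨N, hN⟩ := Trop.exists_card_le (Trop.BCtx.incl O Γ)
  exact ⟨Trop.isTropicalPolynomial_iInf _ _, Trop.isLipschitz_iInf _ _ N fun χ _ => hN χ⟩
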